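/- Let $\mathcal X,\mathcal Y$ be finite nonempty sets and let $P_{Y|X}$ be the transition probabilities of a discrete memoryless channel (DMC) with input alphabet $\mathcal X$ and output alphabet $\mathcal Y$, used without feedback once at each time $t=1,2,\dots$. For a real $r\ge 0$, a rate-$r$ system consists of common randomness $\omega$ (a random element of some probability space, independent of the channel noise and known to encoder and decoder), an encoder which at time $t$ produces the channel input as a function of $\omega$ and of the first $\lfloor rt\rfloor$ bits of an infinite bit stream $b$, and a decoder which at time $t$ produces estimates of the first $\lfloor rt\rfloor$ bits of $b$ as a function of $\omega$ and of the channel outputs $Y_1,\dots,Y_t$. (For integer $r$ this means that one $r$-bit message arrives at each time.) The system achieves (uniform) anytime reliability $\alpha$ if there is a constant $K$ such that, for every bit stream $b$ and all $1\le i\le t$, the probability, over channel noise and common randomness, that at time $t$ at least one of the first $\lfloor ri\rfloor$ bits of $b$ is estimated wrongly is at most $K2^{-\alpha(t-i)}$. The $\alpha$-anytime capacity $C_{\text{any}}(\alpha)\in[0,\infty]$ is the supremum of $r\log 2$ (natural logarithm) over all $r\ge 0$ for which some rate-$r$ system achieves anytime reliability $\alpha$. For $\rho>0$ and a probability distribution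 $P_X$ on $\mathcal X$ put $$E_0(\rho,P_{Y|X},P_X)=-\log\sum_{y\in\mathcal Y}\Big(\sum_{x\in\mathcal X}P_X(x)\,P_{Y|X}(y|x)^{\frac1{1+\rho}}\Big)^{1+\rho},\qquad E_0(\rho)=\sup_{P_X}E_0(\rho,P_{Y|X},P_X).$$ Let $R$ be a positive integer and $m>0$ a real number. If $R\log 2\le C_{\text{any}}(mR)$, then $$R\log 2\le\frac{E_0(m)}{m}.$$ -/

import Mathlib

open MeasureTheory

noncomputable section

/-- Gallager's function `E₀(ρ, W, P)` of a channel with transition probabilities `W x y`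
and an input distribution `P`, in nats. -/
def gallagerE0 {X Y : Type*} [Fintype X] [Fintype Y]
    (ρ : ℝ) (W : X → stdSimplex ℝ Y) (P : stdSimplex ℝ X) : ℝ :=
  -Real.log (∑ y, (∑ x, P x * (W x y) ^ (1 / (1 + ρ))) ^ (1 + ρ))

/-- `E₀(ρ) = sup_P E₀(ρ, W, P)`, the supremum over all input distributions. -/
def gallagerE0Sup {X Y : Type*} [Fintype X] [Fintype Y]
    (ρ : ℝ) (W : X → stdSimplex ℝ Y) : ℝ :=
  ⨆ P : stdSimplex ℝ X, gallagerE0 ρ W P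

/-- The supremum defining `gallagerE0Sup` is a genuine (finite) supremum. -/
theorem bddAbove_gallagerE0 {X Y : Type*} [Fintype X] [Fintype Y]
    {ρ : ℝ} (hρ : 0 < ρ) (W : X → stdSimplex ℝ Y) :
    BddAbove (Set.range (gallagerE0 ρ W)) := by
  have hc : (0 : ℝ) ≤ 1 / (1 + ρ) := by positivity
  have hc' : (0 : ℝ) ≤ 1 + ρ := by positivity
  have hcont : Continuous (gallagerE0 ρ W) := by
    unfold gallagerE0
    refine (Continuous.log ?_ ?_).neg
    · refine continuous_finsetSum _ fun y _ => ?_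
      refine Continuous.rpow_const ?_ fun _ => Or.inr hc'
      refine continuous_finsetSum _ fun x _ => ?_
      exact ((continuous_apply x).comp continuous_subtype_val).mul continuous_const
    · intro P
      have hP : ∑ x, P x = 1 := P.2.2
      obtain ⟨x, hx⟩ : ∃ x, 0 < P x := by
        by_contra! h
        have : ∑ x, P x ≤ 0 := Finset.sum_nonpos fun x _ => h x
        linarith
      obtain ⟨y, hy⟩ : ∃ y, 0 < W x y := by
        by_contra! h
        have h1 : ∑ y, W x y = 1 := (W x).2.2
        have : ∑ y, W x y ≤ 0 := Finset.sum_nonpos fun y _ => h y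
        linarith
      have hnn : ∀ y x, 0 ≤ P x * (W x y) ^ (1 / (1 + ρ)) := fun y x =>
        mul_nonneg (P.2.1 x) (Real.rpow_nonneg ((W x).2.1 y) _)
      refine (Finset.sum_pos' (fun y _ => Real.rpow_nonneg
        (Finset.sum_nonneg fun x _ => hnn y x) _) ⟨y, Finset.mem_univ _, ?_⟩).ne'
      refine Real.rpow_pos_of_pos (Finset.sum_pos' (fun x _ => hnn y x)
        ⟨x, Finset.mem_univ _, mul_pos hx (Real.rpow_pos_of_pos hy _)⟩) _
  exact (isCompact_range hcont).bddAbove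

/-- The number of message bits that have reached the encoder by time `t` when bits arrive at
rate `r` per channel use. For an integer rate these are `t` messages of `r` bits each. -/
def bitsBy (r : ℝ) (t : ℕ) : ℕ := ⌊r * t⌋₊

/-- A rate-`r` sequential communication system without feedback, for a channel with input
alphabet `X` and output alphabet `Y`, used once at each of the times `1, 2, …`.

`enc t ω b` is the channel input at time `t`, where `ω` is the common randomness and `b` the
message bits available at time `t`. `dec t ω y` is the decoder's current estimate, at time `t`,
of all message bits available by then, based on the channel outputs `y` at times `1, …, t`. -/
structure SequentialSystem (X Y : Type*) (r : ℝ) where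
  Ω : Type
  [measurableSpace : MeasurableSpace Ω]
  μ : Measure Ω
  [isProbabilityMeasure : IsProbabilityMeasure μ]
  enc : (t : ℕ) → Ω → (Fin (bitsBy r t) → Bool) → X
  dec : (t : ℕ) → Ω → (Fin t → Y) → (Fin (bitsBy r t) → Bool)
  measurable_enc : ∀ t b x, MeasurableSet {ω | enc t ω b = x}
  measurable_dec : ∀ t y b, MeasurableSet {ω | dec t ω y = b}

attribute [instance] SequentialSystem.measurableSpace SequentialSystem.isProbabilityMeasure

open Classical in
/-- The probability, over the noise of the memoryless channel `W` and the common randomness, that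
at time `t` the decoder is wrong about some of the message bits that arrived by time `i`, when
the bit stream is `b`. Given `ω`, the outputs `y 0, …, y (t-1)` (at times `1, …, t`) are
independent, the one at time `s + 1` with distribution `W (enc (s + 1) ω b)`. -/
def SequentialSystem.errorProb {X Y : Type*} [Fintype Y] {r : ℝ}
    (S : SequentialSystem X Y r) (W : X → stdSimplex ℝ Y) (b : ℕ → Bool) (i t : ℕ) : ℝ :=
  ∫ ω, ∑ y : Fin t → Y,
    (if ∃ k : Fin (bitsBy r t), (k : ℕ) < bitsBy r i ∧ S.dec t ω y k ≠ b k
      then ∏ s : Fin t, W (S.enc ((s : ℕ) + 1) ω fun k => b k) (y s) else 0) ∂S.μ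

/-- Uniform anytime reliability `α`: for every bit stream, the probability of an error in the
messages up to time `i` decays as `K * 2 ^ (-α d)` with the delay `d = t - i`. -/
def SequentialSystem.AchievesReliability {X Y : Type*} [Fintype Y] {r : ℝ}
    (S : SequentialSystem X Y r) (W : X → stdSimplex ℝ Y) (α : ℝ) : Prop :=
  ∃ K : ℝ, ∀ (b : ℕ → Bool) (i t : ℕ), 1 ≤ i → i ≤ t →
    S.errorProb W b i t ≤ K * (2 : ℝ) ^ (-(α * ((t : ℝ) - (i : ℝ))))

/-- The `α`-anytime capacity, without feedback, of the discrete memoryless channel `W`: the least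
upper bound of the rates of the systems that achieve uniform anytime reliability `α` over `W`.
It is measured in nats per channel use, so that `r` bits count as `r * log 2`. -/
def anytimeCapacity {X Y : Type*} [Fintype Y] (W : X → stdSimplex ℝ Y) (α : ℝ) : EReal :=
  sSup {c : EReal | ∃ r : ℝ, 0 ≤ r ∧ c = ((r * Real.log 2 : ℝ) : EReal) ∧
    ∃ S : SequentialSystem X Y r, S.AchievesReliability W α}

end

/-!
The proof bounds a moment of the decoding delay from both sides.

Fix a system of rate `r` with reliability `α ≥ ρ r`, a block length `n`, and let the first
`⌊r n⌋` bits be uniformly distributed. If the last `d` time steps are not yet decoded at time `n`,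
charge a cost of about `2 ^ (ρ r d)` (`delayCost`). The reliability bounds the expected cost by a linear
function of `n`, since each possible delay contributes at most a constant.

On the other hand, only about `2 ^ (r d)` messages have delay `d`, so the costs raised to the power
`-1/ρ` sum to at most `2 (n + 1)` (`sum_delayCost_rpow_le`). Delay costs therefore behave like the
`ρ`-th powers of guessing ranks, and Arikan's inequality (`sum_rpow_one_add_le_mul`) bounds the
expected cost below, up to a polynomial factor, by `2 ^ (ρ r n)` times Gallager's sum for the
product channel `Wⁿ` and the distribution of the codewords. By the optimality condition for a
minimizing one-letter distribution `P` (`exists_gallagerSum_le`), the latter sum is at least the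
`n`-th power of the one-letter sum at `P`, although the codewords need not be product distributed
(`gallagerSum_pow_mul_le`). Comparing exponential rates gives `ρ r log 2 ≤ E₀(ρ)`. All of this is
done conditionally on the common randomness, which is averaged out at the end.

Rates `r` arbitrarily close to `R`, or above it, achieve reliability `m R`. The choice
`ρ = min m (m R / r)` and the monotonicity of `E₀` in `ρ` then give `m R log 2 ≤ E₀(m)`.
-/

/-! ### Gallager's function and its optimal input distribution -/

/-- Gallager's sum `∑_y (∑_x P(x) W(y|x)^{1/(1+ρ)})^{1+ρ}`, whose negated logarithm is
`gallagerE0 ρ W P`. -/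
noncomputable def gallagerSum {X Y : Type*} [Fintype X] [Fintype Y]
    (ρ : ℝ) (W : X → stdSimplex ℝ Y) (P : stdSimplex ℝ X) : ℝ :=
  ∑ y, (∑ x, P x * (W x y) ^ (1 / (1 + ρ))) ^ (1 + ρ)

theorem gallagerSum_pos {X Y : Type*} [Fintype X] [Fintype Y]
    (ρ : ℝ) (W : X → stdSimplex ℝ Y) (P : stdSimplex ℝ X) : 0 < gallagerSum ρ W P := by
  have hP : ∑ x, P x = 1 := P.2.2
  obtain ⟨x, hx⟩ : ∃ x, 0 < P x := by
    by_contra! h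
    have : ∑ x, P x ≤ 0 := Finset.sum_nonpos fun x _ => h x
    linarith
  obtain ⟨y, hy⟩ : ∃ y, 0 < W x y := by
    by_contra! h
    have h1 : ∑ y, W x y = 1 := (W x).2.2
    have : ∑ y, W x y ≤ 0 := Finset.sum_nonpos fun y _ => h y
    linarith
  have hnn : ∀ y x, 0 ≤ P x * (W x y) ^ (1 / (1 + ρ)) := fun y x =>
    mul_nonneg (P.2.1 x) (Real.rpow_nonneg ((W x).2.1 y) _)
  refine Finset.sum_pos' (fun y _ => Real.rpow_nonneg
    (Finset.sum_nonneg fun x _ => hnn y x) _) ⟨y, Finset.mem_univ _, ?_⟩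
  exact Real.rpow_pos_of_pos (Finset.sum_pos' (fun x _ => hnn y x)
    ⟨x, Finset.mem_univ _, mul_pos hx (Real.rpow_pos_of_pos hy _)⟩) _

theorem continuous_gallagerSum {X Y : Type*} [Fintype X] [Fintype Y]
    {ρ : ℝ} (hρ : 0 < ρ) (W : X → stdSimplex ℝ Y) : Continuous (gallagerSum ρ W) := by
  unfold gallagerSum
  refine continuous_finsetSum _ fun y _ => ?_
  refine Continuous.rpow_const ?_ fun _ => Or.inr (by positivity)
  refine continuous_finsetSum _ fun x _ => ?_
  exact ((continuous_apply x).comp continuous_subtype_val).mul continuous_const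

/-- Each summand is an `L^p` norm of `W(y|·)` under `P` with `p = 1/(1+ρ)`, and `L^p` norms over a
probability space increase with `p`. -/
theorem gallagerSum_anti {X Y : Type*} [Fintype X] [Fintype Y] {ρ m : ℝ} (hρ : 0 < ρ)
    (hm : ρ ≤ m) (W : X → stdSimplex ℝ Y) (P : stdSimplex ℝ X) :
    gallagerSum m W P ≤ gallagerSum ρ W P := by
  refine Finset.sum_le_sum fun y _ => ?_
  have h1 : (0 : ℝ) < 1 + ρ := by positivity
  have h2 : (0 : ℝ) < 1 + m := by linarith
  have hW : ∀ x, 0 ≤ (W x) y := fun x => (W x).2.1 y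
  have hP : ∀ x, 0 ≤ P x := P.2.1
  have hq : 1 ≤ (1 + m) / (1 + ρ) := by rw [one_le_div h1]; linarith
  have key := Real.rpow_arith_mean_le_arith_mean_rpow Finset.univ (fun x => P x)
    (fun x => (W x y) ^ (1 / (1 + m))) (fun x _ => hP x) P.2.2
    (fun x _ => Real.rpow_nonneg (hW x) _) hq
  have e1 : ∀ x, ((W x y) ^ (1 / (1 + m))) ^ ((1 + m) / (1 + ρ)) = (W x y) ^ (1 / (1 + ρ)) := by
    intro x
    rw [← Real.rpow_mul (hW x)]
    congr 1
    field_simp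
  simp only [e1] at key
  have hs : 0 ≤ ∑ x, P x * (W x y) ^ (1 / (1 + m)) :=
    Finset.sum_nonneg fun x _ => mul_nonneg (hP x) (Real.rpow_nonneg (hW x) _)
  have e2 : (1 + m) / (1 + ρ) * (1 + ρ) = 1 + m := by field_simp
  calc _ = ((∑ x, P x * (W x y) ^ (1 / (1 + m))) ^ ((1 + m) / (1 + ρ))) ^ (1 + ρ) := by
        rw [← Real.rpow_mul hs, e2]
    _ ≤ _ := Real.rpow_le_rpow (Real.rpow_nonneg hs _) key h1.le

/-- The optimality (Kuhn–Tucker) condition at an input distribution `P` that minimizes Gallager's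
sum: moving mass towards a single input letter `x` does not decrease the sum to first order. -/
theorem exists_gallagerSum_le {X Y : Type*} [Fintype X] [Nonempty X] [Fintype Y] {ρ : ℝ}
    (hρ : 0 < ρ) (W : X → stdSimplex ℝ Y) :
    ∃ P : stdSimplex ℝ X, ∀ x, gallagerSum ρ W P ≤
      ∑ y, (W x y) ^ (1 / (1 + ρ)) * (∑ x', P x' * (W x' y) ^ (1 / (1 + ρ))) ^ ρ := by
  classical
  obtain ⟨x₀⟩ := ‹Nonempty X›
  obtain ⟨P, -, hP⟩ := isCompact_univ.exists_isMinOn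
    ⟨(⟨_, single_mem_stdSimplex ℝ x₀⟩ : stdSimplex ℝ X), Set.mem_univ _⟩
    (continuous_gallagerSum hρ W).continuousOn
  refine ⟨P, fun x => ?_⟩
  set s : ℝ := 1 / (1 + ρ) with hs
  set α : Y → ℝ := fun y => ∑ x', P x' * (W x' y) ^ s with hα
  have hα0 : ∀ y, 0 ≤ α y := fun y =>
    Finset.sum_nonneg fun x' _ => mul_nonneg (P.2.1 x') (Real.rpow_nonneg ((W x').2.1 y) _)
  let f : ℝ → ℝ := fun t => ∑ y, (α y + t * ((W x y) ^ s - α y)) ^ (1 + ρ)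
  have hd : HasDerivAt f (∑ y, ((W x y) ^ s - α y) * (1 + ρ) * (α y) ^ ρ) 0 := by
    refine HasDerivAt.fun_sum fun y _ => ?_
    have h1 : HasDerivAt (fun t : ℝ => α y + t * ((W x y) ^ s - α y)) ((W x y) ^ s - α y) 0 := by
      simpa using ((hasDerivAt_id (0 : ℝ)).mul_const ((W x y) ^ s - α y)).const_add (α y)
    have h2 := h1.rpow_const (p := 1 + ρ) (Or.inr (by linarith))
    simpa using h2
  have hmin : ∀ t ∈ Set.Ioo (0 : ℝ) 1, f 0 ≤ f t := by
    intro t ht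
    have hmem := (convex_stdSimplex ℝ X) P.2 (single_mem_stdSimplex ℝ x)
      (a := 1 - t) (b := t) (by linarith [ht.2]) ht.1.le (by ring)
    have h := hP (Set.mem_univ (⟨_, hmem⟩ : stdSimplex ℝ X))
    have e0 : f 0 = gallagerSum ρ W P := by simp [f, gallagerSum, hα, hs]
    have e1 : f t = gallagerSum ρ W ⟨_, hmem⟩ := by
      refine Finset.sum_congr rfl fun y _ => ?_
      congr 1
      have e2 : ∀ x', (⟨_, hmem⟩ : stdSimplex ℝ X) x'
          = (1 - t) * P x' + t * (Pi.single x (1 : ℝ) : X → ℝ) x' := fun x' => rfl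
      simp only [e2, add_mul, Finset.sum_add_distrib, mul_assoc, ← Finset.mul_sum,
        Pi.single_apply, ite_mul, one_mul, zero_mul, Finset.sum_ite_eq', Finset.mem_univ, if_true]
      simp only [hα, hs]
      ring
    rw [e0, e1]
    exact h
  have hnn : 0 ≤ ∑ y, ((W x y) ^ s - α y) * (1 + ρ) * (α y) ^ ρ := by
    refine ge_of_tendsto hd.tendsto_slope_zero_right ?_
    filter_upwards [Ioo_mem_nhdsGT (zero_lt_one' ℝ)] with t ht
    have h1 := hmin t ht
    have h2 : 0 < t⁻¹ := inv_pos.2 ht.1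
    simp only [zero_add, smul_eq_mul]
    exact mul_nonneg h2.le (by linarith)
  have e : ∑ y, ((W x y) ^ s - α y) * (1 + ρ) * (α y) ^ ρ
      = (1 + ρ) * (∑ y, (W x y) ^ s * (α y) ^ ρ - gallagerSum ρ W P) := by
    unfold gallagerSum
    rw [← Finset.sum_sub_distrib, Finset.mul_sum]
    refine Finset.sum_congr rfl fun y _ => ?_
    have : (α y) ^ (1 + ρ) = α y * (α y) ^ ρ := by
      rw [Real.rpow_add' (hα0 y) (by positivity), Real.rpow_one]
    change _ = (1 + ρ) * ((W x y) ^ s * (α y) ^ ρ - (α y) ^ (1 + ρ))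
    rw [this]
    ring
  rw [e] at hnn
  have := nonneg_of_mul_nonneg_right hnn (by linarith)
  linarith

/-! ### Hölder's inequality, product channels and guessing -/

theorem sum_mul_rpow_one_add_le {ι : Type*} (t : Finset ι) {f g : ι → ℝ} {ρ : ℝ} (hρ : 0 < ρ)
    (hf : ∀ i ∈ t, 0 ≤ f i) (hg : ∀ i ∈ t, 0 ≤ g i) :
    (∑ i ∈ t, f i * g i) ^ (1 + ρ)
      ≤ (∑ i ∈ t, f i ^ (1 + ρ)) * (∑ i ∈ t, g i ^ ((1 + ρ) / ρ)) ^ ρ := by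
  have hpq : (1 + ρ).HolderConjugate ((1 + ρ) / ρ) := by
    rw [Real.holderConjugate_iff]
    refine ⟨by linarith, ?_⟩
    field_simp
  have h := Real.inner_le_Lp_mul_Lq_of_nonneg t hpq hf hg
  have h1 : 0 ≤ ∑ i ∈ t, f i ^ (1 + ρ) :=
    Finset.sum_nonneg fun i hi => Real.rpow_nonneg (hf i hi) _
  have h2 : 0 ≤ ∑ i ∈ t, g i ^ ((1 + ρ) / ρ) :=
    Finset.sum_nonneg fun i hi => Real.rpow_nonneg (hg i hi) _
  have h3 : 0 ≤ ∑ i ∈ t, f i * g i :=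
    Finset.sum_nonneg fun i hi => mul_nonneg (hf i hi) (hg i hi)
  refine (Real.rpow_le_rpow h3 h (by linarith)).trans_eq ?_
  rw [Real.mul_rpow (Real.rpow_nonneg h1 _) (Real.rpow_nonneg h2 _), ← Real.rpow_mul h1,
    ← Real.rpow_mul h2]
  congr 1
  · rw [one_div_mul_cancel (by positivity), Real.rpow_one]
  · congr 1
    field_simp

/-- Gallager's sum of the product channel `Wⁿ`, for the uniform distribution on the words
`c b`, is at least the `n`-th power of the minimal one-letter sum. The hypothesis `hP` is the
optimality condition of `exists_gallagerSum_le`. It passes to products letter by letter, and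
Hölder's inequality turns it back into a bound on the sum. -/
theorem gallagerSum_pow_mul_le {X Y B : Type*} [Fintype X] [Fintype Y] [Fintype B]
    {ρ : ℝ} (hρ : 0 < ρ) (W : X → stdSimplex ℝ Y) (P : stdSimplex ℝ X)
    (hP : ∀ x, gallagerSum ρ W P ≤
      ∑ y, (W x y) ^ (1 / (1 + ρ)) * (∑ x', P x' * (W x' y) ^ (1 / (1 + ρ))) ^ ρ)
    {n : ℕ} (c : B → Fin n → X) :
    gallagerSum ρ W P ^ n * (Fintype.card B : ℝ) ^ (1 + ρ) ≤
      ∑ y : Fin n → Y, (∑ b, (∏ s, W (c b s) (y s)) ^ (1 / (1 + ρ))) ^ (1 + ρ) := by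
  set A := gallagerSum ρ W P with hA
  have hA0 : 0 < A := gallagerSum_pos ρ W P
  set α : Y → ℝ := fun y => ∑ x', P x' * (W x' y) ^ (1 / (1 + ρ)) with hα
  have hα0 : ∀ y, 0 ≤ α y := fun y =>
    Finset.sum_nonneg fun x' _ => mul_nonneg (P.2.1 x') (Real.rpow_nonneg ((W x').2.1 y) _)
  have hW : ∀ x y, 0 ≤ W x y := fun x y => (W x).2.1 y
  have hg0 : ∀ y : Fin n → Y, 0 ≤ ∑ b, (∏ s, W (c b s) (y s)) ^ (1 / (1 + ρ)) := fun y =>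
    Finset.sum_nonneg fun b _ => Real.rpow_nonneg (Finset.prod_nonneg fun s _ => hW _ _) _
  have hh0 : ∀ y : Fin n → Y, 0 ≤ ∏ s, α (y s) := fun y => Finset.prod_nonneg fun s _ => hα0 _
  have holder := sum_mul_rpow_one_add_le (Finset.univ : Finset (Fin n → Y)) hρ
    (f := fun y => ∑ b, (∏ s, W (c b s) (y s)) ^ (1 / (1 + ρ)))
    (g := fun y => (∏ s, α (y s)) ^ ρ)
    (fun y _ => hg0 y) (fun y _ => Real.rpow_nonneg (hh0 y) _)
  have e1 : ∑ y : Fin n → Y, ((∏ s, α (y s)) ^ ρ) ^ ((1 + ρ) / ρ) = A ^ n := by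
    rw [hA, gallagerSum, Fintype.sum_pow]
    refine Finset.sum_congr rfl fun y _ => ?_
    rw [← Real.rpow_mul (hh0 y), Real.finsetProd_rpow _ _ fun s _ => hα0 (y s)]
    congr 1
    field_simp
  have e2 : (Fintype.card B : ℝ) * A ^ n ≤
      ∑ y : Fin n → Y, (∑ b, (∏ s, W (c b s) (y s)) ^ (1 / (1 + ρ))) * (∏ s, α (y s)) ^ ρ := by
    simp only [Finset.sum_mul]
    rw [Finset.sum_comm, ← nsmul_eq_mul, ← Finset.card_univ]
    refine Finset.card_nsmul_le_sum _ _ _ fun b _ => ?_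
    calc A ^ n = ∏ _s : Fin n, A := by simp
      _ ≤ ∏ s : Fin n, ∑ y, (W (c b s) y) ^ (1 / (1 + ρ)) * (α y) ^ ρ :=
        Finset.prod_le_prod (fun _ _ => hA0.le) fun s _ => hP (c b s)
      _ = ∑ y : Fin n → Y, ∏ s, ((W (c b s) (y s)) ^ (1 / (1 + ρ)) * (α (y s)) ^ ρ) := by
        rw [Finset.prod_univ_sum, Fintype.piFinset_univ]
      _ = _ := by
        refine Finset.sum_congr rfl fun y _ => ?_
        rw [Finset.prod_mul_distrib, Real.finsetProd_rpow _ _ fun s _ => hW _ _,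
          Real.finsetProd_rpow _ _ fun s _ => hα0 _]
  rw [e1] at holder
  have e3 := (Real.rpow_le_rpow (by positivity) e2 (by linarith : 0 ≤ 1 + ρ)).trans holder
  have hAn : 0 < A ^ n := by positivity
  rw [Real.mul_rpow (by positivity) hAn.le, Real.rpow_add hAn, Real.rpow_one, ← mul_assoc] at e3
  have := le_of_mul_le_mul_right e3 (Real.rpow_pos_of_pos hAn ρ)
  linarith

/-- Arikan's guessing inequality, with arbitrary positive costs `V b` in place of the `ρ`-th
powers of guessing ranks. -/
theorem sum_rpow_one_add_le_mul {B : Type*} [Fintype B] {ρ : ℝ} (hρ : 0 < ρ) {p V : B → ℝ}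
    (hp : ∀ b, 0 ≤ p b) (hV : ∀ b, 0 < V b) :
    (∑ b, p b ^ (1 / (1 + ρ))) ^ (1 + ρ) ≤ (∑ b, p b * V b) * (∑ b, V b ^ (-(1 / ρ))) ^ ρ := by
  have h1 : (0 : ℝ) < 1 + ρ := by linarith
  have h := sum_mul_rpow_one_add_le (Finset.univ : Finset B) hρ
    (f := fun b => (p b * V b) ^ (1 / (1 + ρ))) (g := fun b => V b ^ (-(1 / (1 + ρ))))
    (fun b _ => Real.rpow_nonneg (mul_nonneg (hp b) (hV b).le) _)
    (fun b _ => Real.rpow_nonneg (hV b).le _)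
  have e1 : ∀ b, (p b * V b) ^ (1 / (1 + ρ)) * V b ^ (-(1 / (1 + ρ))) = p b ^ (1 / (1 + ρ)) := by
    intro b
    rw [Real.mul_rpow (hp b) (hV b).le, mul_assoc, ← Real.rpow_add (hV b), add_neg_cancel,
      Real.rpow_zero, mul_one]
  have e2 : ∀ b, ((p b * V b) ^ (1 / (1 + ρ))) ^ (1 + ρ) = p b * V b := by
    intro b
    rw [← Real.rpow_mul (mul_nonneg (hp b) (hV b).le), one_div_mul_cancel h1.ne', Real.rpow_one]
  have e3 : ∀ b, (V b ^ (-(1 / (1 + ρ)))) ^ ((1 + ρ) / ρ) = V b ^ (-(1 / ρ)) := by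
    intro b
    rw [← Real.rpow_mul (hV b).le]
    congr 1
    field_simp
  simpa only [e1, e2, e3] using h

/-! ### The cost of a decoding delay -/

theorem bitsBy_zero (r : ℝ) : bitsBy r 0 = 0 := by simp [bitsBy]

theorem bitsBy_mono {r : ℝ} (hr : 0 ≤ r) : Monotone (bitsBy r) := fun _ _ hij =>
  Nat.floor_mono (mul_le_mul_of_nonneg_left (Nat.cast_le.2 hij) hr)

open Classical in
/-- The cost of the estimate `est` when the message is `b`: up to a factor at most `n + 1` it is
`2 ^ (ρ * r * d)`, where `d` is the delay, the smallest number such that the bits that arrived by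
time `n - d` are all estimated correctly. It is written as a sum over the error events, whose
probabilities the anytime reliability bounds. -/
noncomputable def delayCost (r ρ : ℝ) {n : ℕ} (est b : Fin (bitsBy r n) → Bool) : ℝ :=
  1 + ∑ i ∈ Finset.Icc 1 n,
    if ∃ k : Fin (bitsBy r n), (k : ℕ) < bitsBy r i ∧ est k ≠ b k
      then (2 : ℝ) ^ (ρ * r * ((n : ℝ) - i + 1)) else 0

theorem one_le_delayCost (r ρ : ℝ) {n : ℕ} (est b : Fin (bitsBy r n) → Bool) :
    1 ≤ delayCost r ρ est b := by
  refine le_add_of_nonneg_right (Finset.sum_nonneg fun i _ => ?_)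
  split_ifs <;> positivity

theorem card_agree_le {N a : ℕ} (ha : a ≤ N) (est : Fin N → Bool) :
    (Finset.univ.filter fun b : Fin N → Bool => ∀ k : Fin N, (k : ℕ) < a → est k = b k).card
      ≤ 2 ^ (N - a) := by
  have h := Finset.card_le_card_of_injOn
    (s := Finset.univ.filter fun b : Fin N → Bool => ∀ k : Fin N, (k : ℕ) < a → est k = b k)
    (t := (Finset.univ : Finset (Fin (N - a) → Bool)))
    (fun b j => b ⟨a + j, by omega⟩) (fun _ _ => Finset.mem_coe.2 (Finset.mem_univ _)) ?_
  · simpa using h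
  · intro b hb b' hb' hbb
    simp only [Finset.coe_filter, Finset.mem_univ, true_and, Set.mem_ofPred_eq] at hb hb'
    funext k
    by_cases hk : (k : ℕ) < a
    · rw [← hb k hk, ← hb' k hk]
    · have := congrFun hbb ⟨k - a, by omega⟩
      have e : (⟨a + (k - a), by omega⟩ : Fin N) = k := Fin.ext (by simp; omega)
      simpa only [e] using this

open Classical in
theorem delayCost_rpow_le {r ρ : ℝ} (hρ : 0 < ρ) {n : ℕ}
    (est b : Fin (bitsBy r n) → Bool) :
    delayCost r ρ est b ^ (-(1 / ρ)) ≤ ∑ j ∈ Finset.range (n + 1),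
      if ∀ k : Fin (bitsBy r n), (k : ℕ) < bitsBy r j → est k = b k
        then (2 : ℝ) ^ (-(r * ((n : ℝ) - j))) else 0 := by
  set Q : ℕ → Prop := fun j => ∀ k : Fin (bitsBy r n), (k : ℕ) < bitsBy r j → est k = b k with hQ
  have h0 : Q 0 := fun k hk => by simp [bitsBy_zero] at hk
  -- `j` is the last time up to which all bits are estimated correctly.
  set j := Nat.findGreatest Q n with hj
  have hjn : j ≤ n := Nat.findGreatest_le n
  have hQj : Q j := Nat.findGreatest_spec (Nat.zero_le n) h0
  have hcost : (2 : ℝ) ^ (ρ * r * ((n : ℝ) - j)) ≤ delayCost r ρ est b := by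
    rcases hjn.eq_or_lt with h | h
    · rw [h, sub_self, mul_zero, Real.rpow_zero]
      exact one_le_delayCost r ρ est b
    · have hnQ : ¬ Q (j + 1) := Nat.findGreatest_is_greatest (Nat.lt_succ_self j) h
      have hex : ∃ k : Fin (bitsBy r n), (k : ℕ) < bitsBy r (j + 1) ∧ est k ≠ b k := by
        simpa [hQ] using hnQ
      have h1 := Finset.single_le_sum (s := Finset.Icc 1 n)
        (f := fun i : ℕ => if ∃ k : Fin (bitsBy r n), (k : ℕ) < bitsBy r i ∧ est k ≠ b k
          then (2 : ℝ) ^ (ρ * r * ((n : ℝ) - i + 1)) else 0)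
        (fun i _ => by split_ifs <;> positivity)
        (Finset.mem_Icc.2 ⟨Nat.succ_le_succ (Nat.zero_le j), h⟩)
      simp only [if_pos hex] at h1
      have e : (n : ℝ) - ((j + 1 : ℕ) : ℝ) + 1 = n - j := by push_cast; ring
      rw [e] at h1
      unfold delayCost
      linarith
  calc delayCost r ρ est b ^ (-(1 / ρ))
      ≤ ((2 : ℝ) ^ (ρ * r * ((n : ℝ) - j))) ^ (-(1 / ρ)) :=
        Real.rpow_le_rpow_of_nonpos (by positivity) hcost (by
          have : 0 < 1 / ρ := by positivity
          linarith)
    _ = (2 : ℝ) ^ (-(r * ((n : ℝ) - j))) := by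
        rw [← Real.rpow_mul (by norm_num)]
        congr 1
        field_simp
    _ = if Q j then (2 : ℝ) ^ (-(r * ((n : ℝ) - j))) else 0 := (if_pos hQj).symm
    _ ≤ _ := Finset.single_le_sum
        (f := fun j : ℕ => if Q j then (2 : ℝ) ^ (-(r * ((n : ℝ) - j))) else 0)
        (fun i _ => by split_ifs <;> positivity) (Finset.mem_range.2 (Nat.lt_succ_of_le hjn))

/-- There are at most `2 ^ (r * d + 1)` messages of delay about `d`, so each of the `n + 1`
possible delays contributes at most `2`. -/
theorem sum_delayCost_rpow_le {r ρ : ℝ} (hr : 0 ≤ r) (hρ : 0 < ρ) {n : ℕ}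
    (est : Fin (bitsBy r n) → Bool) :
    ∑ b, delayCost r ρ est b ^ (-(1 / ρ)) ≤ 2 * ((n : ℝ) + 1) := by
  classical
  refine (Finset.sum_le_sum fun b _ => delayCost_rpow_le hρ est b).trans ?_
  rw [Finset.sum_comm]
  have hterm : ∀ j ∈ Finset.range (n + 1), (∑ b : Fin (bitsBy r n) → Bool,
      if ∀ k : Fin (bitsBy r n), (k : ℕ) < bitsBy r j → est k = b k
        then (2 : ℝ) ^ (-(r * ((n : ℝ) - j))) else 0) ≤ 2 := by
    intro j hj
    have hjn : j ≤ n := Nat.lt_succ_iff.1 (Finset.mem_range.1 hj)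
    have hb := bitsBy_mono hr hjn
    rw [← Finset.sum_filter, Finset.sum_const, nsmul_eq_mul]
    have h1 : (((Finset.univ.filter fun b : Fin (bitsBy r n) → Bool =>
        ∀ k : Fin (bitsBy r n), (k : ℕ) < bitsBy r j → est k = b k).card : ℕ) : ℝ)
        ≤ (2 : ℝ) ^ ((bitsBy r n : ℝ) - bitsBy r j) := by
      rw [← Nat.cast_sub hb, Real.rpow_natCast]
      exact_mod_cast card_agree_le hb est
    have h2 : (bitsBy r n : ℝ) ≤ r * n := Nat.floor_le (by positivity)
    have h3 : r * j - 1 ≤ (bitsBy r j : ℝ) := (Nat.sub_one_lt_floor _).le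
    calc _ ≤ (2 : ℝ) ^ ((bitsBy r n : ℝ) - bitsBy r j) * (2 : ℝ) ^ (-(r * ((n : ℝ) - j))) :=
          mul_le_mul_of_nonneg_right h1 (by positivity)
      _ = (2 : ℝ) ^ ((bitsBy r n : ℝ) - bitsBy r j + -(r * ((n : ℝ) - j))) :=
          (Real.rpow_add (by norm_num) _ _).symm
      _ ≤ (2 : ℝ) ^ (1 : ℝ) := Real.rpow_le_rpow_of_exponent_le (by norm_num) (by linarith)
      _ = 2 := Real.rpow_one 2
  refine (Finset.sum_le_card_nsmul _ _ _ hterm).trans_eq ?_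
  rw [Finset.card_range, nsmul_eq_mul]
  push_cast
  ring

/-! ### Conditional error probabilities of a sequential system -/

open Classical in
/-- The error probability of `SequentialSystem.errorProb`, conditional on the common
randomness `ω`. -/
noncomputable def SequentialSystem.condErrorProb {X Y : Type*} [Fintype Y] {r : ℝ}
    (S : SequentialSystem X Y r) (W : X → stdSimplex ℝ Y) (b : ℕ → Bool) (i t : ℕ) (ω : S.Ω) : ℝ :=
  ∑ y : Fin t → Y,
    (if ∃ k : Fin (bitsBy r t), (k : ℕ) < bitsBy r i ∧ S.dec t ω y k ≠ b k
      then ∏ s : Fin t, W (S.enc ((s : ℕ) + 1) ω fun k => b k) (y s) else 0)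

theorem sum_prod_channel {X Y : Type*} [Fintype Y] (W : X → stdSimplex ℝ Y) {n : ℕ}
    (c : Fin n → X) : ∑ y : Fin n → Y, ∏ s, W (c s) (y s) = 1 := by
  classical
  have h1 : ∀ x, ∑ y, W x y = 1 := fun x => (W x).2.2
  have h := Finset.prod_univ_sum (fun _ : Fin n => (Finset.univ : Finset Y))
    (fun s y => W (c s) y)
  rw [Fintype.piFinset_univ] at h
  rw [← h]
  simp [h1]

theorem prod_channel_nonneg {X Y : Type*} [Fintype Y] (W : X → stdSimplex ℝ Y) {n : ℕ}
    (c : Fin n → X) (y : Fin n → Y) : 0 ≤ ∏ s, W (c s) (y s) :=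
  Finset.prod_nonneg fun s _ => (W (c s)).2.1 (y s)

namespace SequentialSystem

variable {X Y : Type*} [Fintype Y] {r : ℝ} (S : SequentialSystem X Y r) (W : X → stdSimplex ℝ Y)
  (b : ℕ → Bool) (i t : ℕ)

theorem integral_condErrorProb : ∫ ω, S.condErrorProb W b i t ω ∂S.μ = S.errorProb W b i t := rfl

theorem condErrorProb_nonneg (ω : S.Ω) : 0 ≤ S.condErrorProb W b i t ω := by
  refine Finset.sum_nonneg fun y _ => ?_
  split_ifs
  · exact prod_channel_nonneg W (fun s : Fin t => S.enc ((s : ℕ) + 1) ω fun k => b k) y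
  · exact le_rfl

theorem condErrorProb_le_one (ω : S.Ω) : S.condErrorProb W b i t ω ≤ 1 := by
  rw [← sum_prod_channel W (fun s : Fin t => S.enc ((s : ℕ) + 1) ω fun k => b k)]
  refine Finset.sum_le_sum fun y _ => ?_
  split_ifs
  · exact le_rfl
  · exact prod_channel_nonneg W (fun s : Fin t => S.enc ((s : ℕ) + 1) ω fun k => b k) y

theorem measurable_condErrorProb [Finite X] : Measurable (S.condErrorProb W b i t) := by
  classical
  let _ : MeasurableSpace X := ⊤
  have _ : DiscreteMeasurableSpace X := ⟨fun _ => trivial⟩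
  have henc : ∀ t b, Measurable fun ω => S.enc t ω b := fun t b =>
    measurable_to_countable' fun x => S.measurable_enc t b x
  have hdec : ∀ t y, Measurable fun ω => S.dec t ω y := fun t y =>
    measurable_to_countable' fun x => S.measurable_dec t y x
  unfold condErrorProb
  refine Finset.measurable_sum _ fun y _ => Measurable.ite ?_ ?_ measurable_const
  · exact hdec t y (MeasurableSet.of_discrete
      (s := {β | ∃ k : Fin (bitsBy r t), (k : ℕ) < bitsBy r i ∧ β k ≠ b k}))
  · refine Finset.measurable_prod _ fun s _ => ?_
    exact (Measurable.of_discrete (f := fun x => W x (y s))).comp (henc _ _)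

theorem integrable_condErrorProb [Finite X] : Integrable (S.condErrorProb W b i t) S.μ := by
  refine Integrable.of_bound (S.measurable_condErrorProb W b i t).aestronglyMeasurable 1
    (Filter.Eventually.of_forall fun ω => ?_)
  rw [Real.norm_of_nonneg (S.condErrorProb_nonneg W b i t ω)]
  exact S.condErrorProb_le_one W b i t ω

end SequentialSystem

/-- The bit stream that starts with the block `b` and continues with `false`. -/
def extendBits {N : ℕ} (b : Fin N → Bool) (k : ℕ) : Bool :=
  if h : k < N then b ⟨k, h⟩ else false

theorem extendBits_coe {N : ℕ} (b : Fin N → Bool) (k : Fin N) : extendBits b k = b k := by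
  simp [extendBits]

theorem SequentialSystem.sum_mul_delayCost {X Y : Type*} [Fintype Y] {r : ℝ}
    (S : SequentialSystem X Y r) (W : X → stdSimplex ℝ Y) (ρ : ℝ) {n : ℕ}
    (b : Fin (bitsBy r n) → Bool) (ω : S.Ω) :
    ∑ y : Fin n → Y, (∏ s : Fin n, W (S.enc ((s : ℕ) + 1) ω fun k => extendBits b k) (y s))
        * delayCost r ρ (S.dec n ω y) b
      = 1 + ∑ i ∈ Finset.Icc 1 n, (2 : ℝ) ^ (ρ * r * ((n : ℝ) - i + 1))
          * S.condErrorProb W (extendBits b) i n ω := by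
  simp only [delayCost, mul_add, mul_one, Finset.sum_add_distrib, condErrorProb, Finset.mul_sum,
    extendBits_coe]
  rw [sum_prod_channel W fun s : Fin n => S.enc ((s : ℕ) + 1) ω fun k => extendBits b k,
    Finset.sum_comm]
  congr 1
  refine Finset.sum_congr rfl fun i _ => Finset.sum_congr rfl fun y _ => ?_
  split_ifs
  · rw [mul_comm]
  · simp

/-! ### The converse -/

/-- For a system that achieves reliability `α ≥ ρ * r`, the expected delay cost is at most linear
in `n`, while the guessing inequality bounds it below exponentially in `n`. -/
theorem SequentialSystem.gallagerSum_pow_mul_bits_le {X Y : Type*} [Fintype X] [Fintype Y] {r : ℝ}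
    (hr : 0 ≤ r) (S : SequentialSystem X Y r) (W : X → stdSimplex ℝ Y) {α ρ K : ℝ} (hρ : 0 < ρ)
    (hα : ρ * r ≤ α)
    (hK : ∀ (b : ℕ → Bool) (i t : ℕ), 1 ≤ i → i ≤ t →
      S.errorProb W b i t ≤ K * (2 : ℝ) ^ (-(α * ((t : ℝ) - (i : ℝ)))))
    (P : stdSimplex ℝ X)
    (hP : ∀ x, gallagerSum ρ W P ≤
      ∑ y, (W x y) ^ (1 / (1 + ρ)) * (∑ x', P x' * (W x' y) ^ (1 / (1 + ρ))) ^ ρ) (n : ℕ) :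
    gallagerSum ρ W P ^ n * (2 : ℝ) ^ (ρ * bitsBy r n) ≤
      (2 * ((n : ℝ) + 1)) ^ ρ * (1 + n * (|K| * (2 : ℝ) ^ (ρ * r))) := by
  set N := bitsBy r n with hN
  set w : ℕ → ℝ := fun i => (2 : ℝ) ^ (ρ * r * ((n : ℝ) - i + 1)) with hw
  have hM : (Fintype.card (Fin N → Bool) : ℝ) = (2 : ℝ) ^ N := by simp
  have hcond : ∀ ω : S.Ω, gallagerSum ρ W P ^ n * ((2 : ℝ) ^ N) ^ (1 + ρ) ≤
      (2 * ((n : ℝ) + 1)) ^ ρ * ∑ b : Fin N → Bool,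
        (1 + ∑ i ∈ Finset.Icc 1 n, w i * S.condErrorProb W (extendBits b) i n ω) := by
    intro ω
    have h1 := gallagerSum_pow_mul_le hρ W P hP
      (fun (b : Fin N → Bool) (s : Fin n) => S.enc ((s : ℕ) + 1) ω fun k => extendBits b k)
    rw [hM] at h1
    refine h1.trans ?_
    simp only [hw, ← S.sum_mul_delayCost W ρ _ ω]
    rw [Finset.sum_comm, Finset.mul_sum]
    refine Finset.sum_le_sum fun y _ => ?_
    refine (sum_rpow_one_add_le_mul hρ (V := fun b => delayCost r ρ (S.dec n ω y) b)
      (fun b => prod_channel_nonneg W _ y)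
      (fun b => zero_lt_one.trans_le (one_le_delayCost r ρ _ b))).trans ?_
    rw [mul_comm]
    refine mul_le_mul_of_nonneg_right (Real.rpow_le_rpow ?_ (sum_delayCost_rpow_le hr hρ _) hρ.le)
      (Finset.sum_nonneg fun b _ => mul_nonneg (prod_channel_nonneg W _ y)
        (zero_le_one.trans (one_le_delayCost r ρ _ b)))
    exact Finset.sum_nonneg fun b _ =>
      Real.rpow_nonneg (zero_le_one.trans (one_le_delayCost r ρ _ b)) _
  have hint : ∀ b : Fin N → Bool, Integrable (fun ω =>
      1 + ∑ i ∈ Finset.Icc 1 n, w i * S.condErrorProb W (extendBits b) i n ω) S.μ := fun b =>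
    (integrable_const _).add (integrable_finsetSum _ fun i _ =>
      (S.integrable_condErrorProb W _ i n).const_mul _)
  have hmean : gallagerSum ρ W P ^ n * ((2 : ℝ) ^ N) ^ (1 + ρ) ≤
      (2 * ((n : ℝ) + 1)) ^ ρ * ∑ b : Fin N → Bool,
        (1 + ∑ i ∈ Finset.Icc 1 n, w i * S.errorProb W (extendBits b) i n) := by
    have h := integral_mono (integrable_const _)
      ((integrable_finsetSum Finset.univ fun b _ => hint b).const_mul _) hcond
    rw [integral_const, probReal_univ, one_smul, integral_const_mul,
      integral_finsetSum _ fun b _ => hint b] at h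
    refine h.trans_eq ?_
    congr 1
    refine Finset.sum_congr rfl fun b _ => ?_
    rw [integral_add (integrable_const _) (integrable_finsetSum _ fun i _ =>
      (S.integrable_condErrorProb W _ i n).const_mul _), integral_const, probReal_univ, one_smul,
      integral_finsetSum _ fun i _ => (S.integrable_condErrorProb W _ i n).const_mul _]
    simp only [integral_const_mul, S.integral_condErrorProb]
  have hterm : ∀ b : Fin N → Bool,
      1 + ∑ i ∈ Finset.Icc 1 n, w i * S.errorProb W (extendBits b) i n
        ≤ 1 + n * (|K| * (2 : ℝ) ^ (ρ * r)) := by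
    intro b
    have h1 : ∀ i ∈ Finset.Icc 1 n, w i * S.errorProb W (extendBits b) i n
        ≤ |K| * (2 : ℝ) ^ (ρ * r) := by
      intro i hi
      obtain ⟨hi1, hin⟩ := Finset.mem_Icc.1 hi
      have hd : (0 : ℝ) ≤ (n : ℝ) - i := sub_nonneg.2 (Nat.cast_le.2 hin)
      have h2 : S.errorProb W (extendBits b) i n ≤ |K| * (2 : ℝ) ^ (-(α * ((n : ℝ) - i))) :=
        (hK _ i n hi1 hin).trans (mul_le_mul_of_nonneg_right (le_abs_self K) (by positivity))
      calc _ ≤ w i * (|K| * (2 : ℝ) ^ (-(α * ((n : ℝ) - i)))) :=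
            mul_le_mul_of_nonneg_left h2 (by positivity)
        _ = |K| * (2 : ℝ) ^ (ρ * r * ((n : ℝ) - i + 1) + -(α * ((n : ℝ) - i))) := by
            rw [Real.rpow_add (by norm_num)]
            ring
        _ ≤ _ := by
            refine mul_le_mul_of_nonneg_left
              (Real.rpow_le_rpow_of_exponent_le (by norm_num) ?_) (abs_nonneg K)
            nlinarith [mul_le_mul_of_nonneg_right hα hd]
    have h3 := Finset.sum_le_card_nsmul _ _ _ h1
    rw [Nat.card_Icc, Nat.add_sub_cancel, nsmul_eq_mul] at h3
    linarith
  have hsum := Finset.sum_le_card_nsmul Finset.univ _ _ fun b _ => hterm b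
  rw [Finset.card_univ, nsmul_eq_mul, hM] at hsum
  have h2N : (0 : ℝ) < (2 : ℝ) ^ N := by positivity
  have htot := hmean.trans (mul_le_mul_of_nonneg_left hsum (by positivity))
  have e : ((2 : ℝ) ^ N) ^ ρ = (2 : ℝ) ^ (ρ * N) := by
    rw [← Real.rpow_natCast, ← Real.rpow_mul (by norm_num), mul_comm]
  rw [Real.rpow_add h2N, Real.rpow_one, e] at htot
  refine le_of_mul_le_mul_left ?_ h2N
  linarith

theorem le_one_of_pow_le_mul_pow {B C : ℝ} {k : ℕ} (h : ∀ n : ℕ, 1 ≤ n → B ^ n ≤ C * (n : ℝ) ^ k) :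
    B ≤ 1 := by
  by_contra! hB
  have ht := (tendsto_pow_const_div_const_pow_of_one_lt k hB).const_mul C
  rw [mul_zero] at ht
  have h1 : (1 : ℝ) ≤ 0 := by
    refine ge_of_tendsto ht ?_
    filter_upwards [Filter.eventually_ge_atTop 1] with n hn
    have : 0 < B ^ n := by positivity
    rw [← mul_div_assoc, one_le_div this]
    exact h n hn
  linarith

/-- A rate `r` with reliability at least `ρ * r` satisfies `ρ * r * log 2 ≤ E₀(ρ)`. -/
theorem SequentialSystem.mul_log_two_le {X Y : Type*} [Fintype X] [Fintype Y] {r : ℝ}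
    (hr : 0 ≤ r) (S : SequentialSystem X Y r) (W : X → stdSimplex ℝ Y) {α ρ : ℝ} (hρ : 0 < ρ)
    (hα : ρ * r ≤ α) (hS : S.AchievesReliability W α)
    (P : stdSimplex ℝ X)
    (hP : ∀ x, gallagerSum ρ W P ≤
      ∑ y, (W x y) ^ (1 / (1 + ρ)) * (∑ x', P x' * (W x' y) ^ (1 / (1 + ρ))) ^ ρ) :
    ρ * r * Real.log 2 ≤ gallagerE0 ρ W P := by
  obtain ⟨K, hK⟩ := hS
  set A := gallagerSum ρ W P with hA
  have hA0 : 0 < A := gallagerSum_pos ρ W P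
  set D : ℝ := |K| * (2 : ℝ) ^ (ρ * r) with hD
  have hD0 : 0 ≤ D := by positivity
  set k := ⌈ρ⌉₊ with hk
  have key : A * (2 : ℝ) ^ (ρ * r) ≤ 1 := by
    refine le_one_of_pow_le_mul_pow (C := (2 : ℝ) ^ ρ * (4 ^ k * (1 + D))) (k := k + 1)
      fun n hn => ?_
    have hn1 : (1 : ℝ) ≤ n := Nat.one_le_cast.2 hn
    have h := S.gallagerSum_pow_mul_bits_le hr W hρ hα hK P hP n
    have hb : r * n ≤ bitsBy r n + 1 := (Nat.lt_floor_add_one _).le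
    have h1 : ((2 : ℝ) ^ (ρ * r)) ^ n ≤ (2 : ℝ) ^ ρ * (2 : ℝ) ^ (ρ * bitsBy r n) := by
      rw [← Real.rpow_natCast, ← Real.rpow_mul (by norm_num), ← Real.rpow_add (by norm_num)]
      refine Real.rpow_le_rpow_of_exponent_le (by norm_num) ?_
      nlinarith [mul_le_mul_of_nonneg_left hb hρ.le]
    have h2 : (2 * ((n : ℝ) + 1)) ^ ρ ≤ 4 ^ k * (n : ℝ) ^ k := by
      calc (2 * ((n : ℝ) + 1)) ^ ρ ≤ (2 * ((n : ℝ) + 1)) ^ (k : ℝ) :=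
            Real.rpow_le_rpow_of_exponent_le (by linarith) (Nat.le_ceil ρ)
        _ = (2 * ((n : ℝ) + 1)) ^ k := Real.rpow_natCast _ _
        _ ≤ (4 * (n : ℝ)) ^ k := pow_le_pow_left₀ (by positivity) (by linarith) k
        _ = _ := mul_pow _ _ _
    have h3 : 1 + n * D ≤ (1 + D) * n := by nlinarith
    calc (A * (2 : ℝ) ^ (ρ * r)) ^ n = A ^ n * ((2 : ℝ) ^ (ρ * r)) ^ n := mul_pow _ _ _
      _ ≤ A ^ n * ((2 : ℝ) ^ ρ * (2 : ℝ) ^ (ρ * bitsBy r n)) :=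
          mul_le_mul_of_nonneg_left h1 (by positivity)
      _ = (2 : ℝ) ^ ρ * (A ^ n * (2 : ℝ) ^ (ρ * bitsBy r n)) := by ring
      _ ≤ (2 : ℝ) ^ ρ * ((4 ^ k * (n : ℝ) ^ k) * ((1 + D) * n)) := by
          refine mul_le_mul_of_nonneg_left (h.trans ?_) (by positivity)
          exact mul_le_mul h2 h3 (by positivity) (by positivity)
      _ = _ := by ring
  have hlog := Real.log_nonpos (by positivity) key
  rw [Real.log_mul hA0.ne' (by positivity), Real.log_rpow (by norm_num)] at hlog
  change _ ≤ -Real.log A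
  linarith

theorem gallagerE0_mono {X Y : Type*} [Fintype X] [Fintype Y] {ρ m : ℝ} (hρ : 0 < ρ)
    (hm : ρ ≤ m) (W : X → stdSimplex ℝ Y) (P : stdSimplex ℝ X) :
    gallagerE0 ρ W P ≤ gallagerE0 m W P :=
  neg_le_neg (Real.log_le_log (gallagerSum_pos m W P) (gallagerSum_anti hρ hm W P))

theorem corollary2 {X Y : Type*} [Fintype X] [Nonempty X] [Fintype Y]
    (W : X → stdSimplex ℝ Y) (R : ℕ) (hR : 0 < R) (m : ℝ) (hm : 0 < m)
    (h : (((R : ℝ) * Real.log 2 : ℝ) : EReal) ≤ anytimeCapacity W (m * (R : ℝ))) :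
    (R : ℝ) * Real.log 2 ≤ gallagerE0Sup m W / m := by
  have hR' : (0 : ℝ) < R := Nat.cast_pos.2 hR
  have hlog : 0 < Real.log 2 := Real.log_pos (by norm_num)
  have hRl : 0 < (R : ℝ) * Real.log 2 := by positivity
  refine le_of_forall_lt_imp_le_of_dense fun c₀ hc₀ => ?_
  obtain ⟨c, hcm, hc⟩ := exists_between (max_lt hc₀ hRl)
  have hc0 : 0 < c := (le_max_right _ _).trans_lt hcm
  refine ((le_max_left _ _).trans hcm.le).trans ?_
  obtain ⟨_, ⟨r, hr, rfl, S, hS⟩, hcr⟩ := lt_sSup_iff.1 ((EReal.coe_lt_coe_iff.2 hc).trans_le h)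
  rw [EReal.coe_lt_coe_iff] at hcr
  have hr0 : 0 < r := pos_of_mul_pos_left (hc0.trans hcr) hlog.le
  -- The largest moment `ρ ≤ m` that the reliability `m * R` controls at rate `r`. For `r > R` it
  -- is smaller than `m`, and the monotonicity of `E₀` makes up for the difference.
  set ρ := min m (m * R / r) with hρdef
  have hρ : 0 < ρ := lt_min hm (by positivity)
  have hρr : ρ * r ≤ m * R := (le_div_iff₀ hr0).1 (min_le_right _ _)
  have hmc : m * c ≤ ρ * r * Real.log 2 := by
    rcases min_choice m (m * R / r) with e | e
    · rw [hρdef, e, mul_assoc]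
      exact mul_le_mul_of_nonneg_left hcr.le hm.le
    · rw [hρdef, e, div_mul_cancel₀ _ hr0.ne', mul_assoc]
      exact mul_le_mul_of_nonneg_left hc.le hm.le
  obtain ⟨P, hP⟩ := exists_gallagerSum_le hρ W
  rw [le_div_iff₀ hm, mul_comm]
  calc m * c ≤ ρ * r * Real.log 2 := hmc
    _ ≤ gallagerE0 ρ W P := S.mul_log_two_le hr W hρ hρr hS P hP
    _ ≤ gallagerE0 m W P := gallagerE0_mono hρ (min_le_left _ _) W P
    _ ≤ gallagerE0Sup m W := le_ciSup (bddAbove_gallagerE0 hm W) P
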